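/- **Problem.** Let $n\ge 0$, $m\ge 1$ and consider $$\min_{x\in\mathbb R^n} P_1(x)-P_2(x)\quad\text{s.t. } g_i(x)\le 0\ (i=1,\dots,m),\quad x\in C, \tag{1}$$ where $P_1,P_2:\mathbb R^n\to\mathbb R$ are convex, each $g_i:\mathbb R^n\to\mathbb R$ is differentiable with Lipschitz continuous gradient, $C\subseteq\mathbb R^n$ is nonempty, compact and convex, and the feasible set of (1) is nonempty. Write $g_i=g_i^1-g_i^2$ with $g_i^1,g_i^2$ convex and differentiable, $\nabla g_i^1$ Lipschitz with modulus $L_{g_i}>0$ and $\nabla g_i^2$ Lipschitz with modulus $\ell_{g_i}\in[0,L_{g_i}]$. Put $L_g=\max_iL_{g_i}$, $\ell_g=\max_i\ell_{g_i}$, $[t]_+=\max\{t,0\}$ and $\mathrm{lin}_{g_i}(u,w)=g_i(w)+\langle\nabla g_i(w),u-w\rangle$. **Algorithm 1.** Choose $x^{-1}=x^0\in C$, $\theta_0>0$, $d>0$, and $\beta_k\in\big[0,\sqrt{L_g/(L_g+\ell_g)}\big)$ with $\sup_k\beta_k<\sqrt{L_g/(L_g+\ell_g)}$. For $k=0,1,2,\dots$: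 set $y^k=x^k+\beta_k(x^k-x^{k-1})$; take any $\xi^k\in\partial P_2(x^k)$; let $(x^{k+1},s^{k+1})$ minimize $$P_1(x)-\langle\xi^k,x\rangle+\theta_ks+\tfrac{\theta_kL_g}{2}\|x-y^k\|^2$$ over all $(x,s)\in C\times[0,\infty)$ with $\mathrm{lin}_{g_i}(x,y^k)\le s$ for all $i$; set $\theta_{k+1}=\theta_k$ if $\mathrm{lin}_{g_i}(x^{k+1},y^k)\le 0$ for all $i$, and $\theta_{k+1}=\theta_k+d$ otherwise. **Kurdyka–Łojasiewicz exponent.** Let $\partial f$ be the limiting subdifferential and $\operatorname{dom}\partial f=\{x:\partial f(x)\ne\emptyset\}$. A proper lower semicontinuous $f:\mathbb R^n\to(-\infty,+\infty]$ is a KL function with exponent $\alpha\in[0,1)$ if for every $\bar x\in\operatorname{dom}\partial f$ there are $\rho>0$, $r\in(0,\infty]$ and a neighborhood $U$ of $\bar x$ such that, with $\phi(t)=\rho t^{1-\alpha}$, $\phi'(f(x)-f(\bar x))\,\mathrm{dist}(0,\partial f(x))\ge 1$ for all $x\in U$ with $f(\bar x)<f(x)<f(\bar x)+r$ (where $\mathrm{dist}(0,\emptyset)=+\infty$).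 Let $\delta_C$ be the indicator function of $C$ (equal to $0$ on $C$ and $+\infty$ elsewhere), $\hat m=\inf_{x\in C}P_1(x)$, and, for $\eta,\theta>0$, $$F_\eta(x)=\tfrac1\eta(P_1(x)-\hat m)+\delta_C(x)+\max_i[g_i(x)]_+,$$ $$E(x,y,\theta)=\tfrac1\theta\Big(P_1(x)-\hat m+\delta_C(x)+\theta\max_i[g_i(x)]_++\tfrac{\theta L_g}{2}\|x-y\|^2\Big).$$ **Theorem.** Assume that $P_2=0$, that every $g_i$ is convex and $\ell_{g_i}=0$ for all $i$, and that there is a Slater point $\hat x\in C$ with $g_i(\hat x)<0$ for all $i$. Let $\{(x^k,\theta_k)\}$ be generated by Algorithm 1. Then: (i) For every $k\ge 1$, $$E(x^{k+1},x^k,\theta_{k+1})\le E(x^k,x^{k-1},\theta_k)-\frac{(1-\beta_k^2)L_g}{2}\|x^k-x^{k-1}\|^2.$$ (ii) The set $\Omega$ of accumulation points of $\{(x^{k+1},x^k,\theta_k)\}$ is nonempty and compact, $\bar\omega:=\lim_{k\to\infty}E(x^{k+1},x^k,\theta_k)$ exists in $\mathbb R$, and $E\equiv\bar\omega$ on $\Omega$.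 (iii) There are $\hat\theta$ and $N_0$ with $\theta_k=\hat\theta$ for all $k\ge N_0$. If $F_{\hat\theta}$ is a KL function with exponent $\frac12$, then $\{x^k\}$ converges to a minimizer $x^*$ of (1), and there exist $c_0>0$, $s\in(0,1)$ and $k_0\in\mathbb N$ such that $\|x^k-x^*\|\le c_0s^k$ for all $k>k_0$. -/

import Mathlib

open Filter Topology
open scoped NNReal

namespace ESQM

noncomputable section

section VariationalAnalysis

variable {E : Type*} [NormedAddCommGroup E] [InnerProductSpace ℝ E]

/-- The indicator function `δ_D`: `0` on `D`, `+∞` off `D`. -/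
def indicatorFn (D : Set E) (x : E) : EReal :=
  open Classical in if x ∈ D then 0 else ⊤

/-- The effective domain of an extended-real-valued function. -/
def effDom (f : E → EReal) : Set E := {x | f x < ⊤}

/-- A proper function `f : E → (-∞, +∞]`. -/
def IsProper (f : E → EReal) : Prop := (∀ x, f x ≠ ⊥) ∧ (effDom f).Nonempty

/-- The regular (Fréchet) subdifferential of `f` at `w`; empty off the domain of `f`. -/
def regularSubdifferential (f : E → EReal) (w : E) : Set E :=
  {ξ | w ∈ effDom f ∧
    0 ≤ liminf (fun v : E =>
      (f v - f w - ((inner ℝ ξ (v - w) : ℝ) : EReal)) / ((‖v - w‖ : ℝ) : EReal)) (𝓝[≠] w)}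

/-- The limiting subdifferential of `f` at `w`; empty off the domain of `f`. -/
def subdifferential (f : E → EReal) (w : E) : Set E :=
  {ξ | w ∈ effDom f ∧ ∃ (u : ℕ → E) (ζ : ℕ → E),
    Tendsto u atTop (𝓝 w) ∧ Tendsto (fun k => f (u k)) atTop (𝓝 (f w)) ∧
    Tendsto ζ atTop (𝓝 ξ) ∧ ∀ k, ζ k ∈ regularSubdifferential f (u k)}

/-- The set `dom ∂f` of points at which the limiting subdifferential is nonempty. -/
def domSubdifferential (f : E → EReal) : Set E := {x | (subdifferential f x).Nonempty}

/-- `φ : [0, r) → ℝ₊` is continuous and concave with `φ 0 = 0`, and it is continuously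
differentiable on `(0, r)` with positive derivative. Here `r ∈ (0, ∞]`. -/
structure IsDesingularizing (φ : ℝ → ℝ) (r : EReal) : Prop where
  continuousOn : ContinuousOn φ {t : ℝ | 0 ≤ t ∧ (t : EReal) < r}
  concaveOn : ConcaveOn ℝ {t : ℝ | 0 ≤ t ∧ (t : EReal) < r} φ
  nonneg : ∀ t : ℝ, 0 ≤ t → (t : EReal) < r → 0 ≤ φ t
  map_zero : φ 0 = 0
  differentiableAt : ∀ t : ℝ, 0 < t → (t : EReal) < r → DifferentiableAt ℝ φ t
  continuousOn_deriv : ContinuousOn (deriv φ) {t : ℝ | 0 < t ∧ (t : EReal) < r}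
  deriv_pos : ∀ t : ℝ, 0 < t → (t : EReal) < r → 0 < deriv φ t

/-- `f` satisfies the KL property at `a ∈ dom ∂f` with the desingularizing function `φ`:
`φ'(f(x) - f(a)) * dist(0, ∂f(x)) ≥ 1` for all `x` near `a` with `f(a) < f(x) < f(a) + r`.
The distance to the empty set is `∞`. -/
def HasKLWith (f : E → EReal) (a : E) (φ : ℝ → ℝ) : Prop :=
  a ∈ domSubdifferential f ∧ ∃ r : EReal, 0 < r ∧ IsDesingularizing φ r ∧ ∃ U ∈ 𝓝 a,
    ∀ x ∈ U, f a < f x → f x < f a + r →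
      1 ≤ ENNReal.ofReal (deriv φ ((f x).toReal - (f a).toReal)) *
        Metric.infEDist 0 (subdifferential f x)

/-- `f` satisfies the KL property with exponent `α ∈ [0, 1)` at `a`. -/
def HasKLExponentAt (f : E → EReal) (α : ℝ) (a : E) : Prop :=
  0 ≤ α ∧ α < 1 ∧ ∃ ρ : ℝ, 0 < ρ ∧ HasKLWith f a (fun t => ρ * t ^ (1 - α))

/-- A proper closed function that satisfies the KL property with exponent `α` at every
point of `dom ∂f`. -/
structure IsKLFunctionWithExponent (f : E → EReal) (α : ℝ) : Prop where
  proper : IsProper f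
  closed : LowerSemicontinuous f
  exponent : ∀ a ∈ domSubdifferential f, HasKLExponentAt f α a

end VariationalAnalysis

/-- The problem: minimize `P₁ - P₂` over `x ∈ C` with `g i x ≤ 0` for `i = 1, …, m`. -/
structure DCProgram (n m : ℕ) where
  P₁ : EuclideanSpace ℝ (Fin n) → ℝ
  P₂ : EuclideanSpace ℝ (Fin n) → ℝ
  g : Fin m → EuclideanSpace ℝ (Fin n) → ℝ
  C : Set (EuclideanSpace ℝ (Fin n))
  convex_P₁ : ConvexOn ℝ Set.univ P₁
  convex_P₂ : ConvexOn ℝ Set.univ P₂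
  differentiable_g : ∀ i, Differentiable ℝ (g i)
  lipschitz_gradient_g : ∀ i, ∃ K : ℝ≥0, LipschitzWith K (gradient (g i))
  nonempty_C : C.Nonempty
  compact_C : IsCompact C
  convex_C : Convex ℝ C
  feasible_nonempty : (C ∩ {x | ∀ i, g i x ≤ 0}).Nonempty

/-- A splitting `g i = g₁ i - g₂ i` into convex functions with Lipschitz gradients, with
chosen Lipschitz moduli `L i > 0` of `∇(g₁ i)` and `ℓ i ≥ 0` of `∇(g₂ i)`, `ℓ i ≤ L i`. -/
structure ConstraintSplitting {n m : ℕ} (p : DCProgram n m) where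
  g₁ : Fin m → EuclideanSpace ℝ (Fin n) → ℝ
  g₂ : Fin m → EuclideanSpace ℝ (Fin n) → ℝ
  L : Fin m → ℝ≥0
  ℓ : Fin m → ℝ≥0
  g_eq : ∀ i x, p.g i x = g₁ i x - g₂ i x
  convex_g₁ : ∀ i, ConvexOn ℝ Set.univ (g₁ i)
  convex_g₂ : ∀ i, ConvexOn ℝ Set.univ (g₂ i)
  differentiable_g₁ : ∀ i, Differentiable ℝ (g₁ i)
  differentiable_g₂ : ∀ i, Differentiable ℝ (g₂ i)
  lipschitz_g₁ : ∀ i, LipschitzWith (L i) (gradient (g₁ i))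
  lipschitz_g₂ : ∀ i, LipschitzWith (ℓ i) (gradient (g₂ i))
  L_pos : ∀ i, 0 < L i
  ℓ_le_L : ∀ i, ℓ i ≤ L i

section Program

variable {n m : ℕ}

namespace ConstraintSplitting

variable [NeZero m] {p : DCProgram n m}

/-- `L_g = max_i L i`. -/
def Lg (σ : ConstraintSplitting p) : ℝ :=
  Finset.univ.sup' Finset.univ_nonempty (fun i => (σ.L i : ℝ))

/-- `ℓ_g = max_i ℓ i`. -/
def ℓg (σ : ConstraintSplitting p) : ℝ :=
  Finset.univ.sup' Finset.univ_nonempty (fun i => (σ.ℓ i : ℝ))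

end ConstraintSplitting

namespace DCProgram

/-- The objective `P = P₁ - P₂`. -/
def P (p : DCProgram n m) (x : EuclideanSpace ℝ (Fin n)) : ℝ := p.P₁ x - p.P₂ x

/-- The feasible set `{x ∈ C : g i x ≤ 0 for all i}`. -/
def feasible (p : DCProgram n m) : Set (EuclideanSpace ℝ (Fin n)) :=
  p.C ∩ {x | ∀ i, p.g i x ≤ 0}

/-- `x` is a (global) minimizer of the problem. -/
def IsMinimizer (p : DCProgram n m) (x : EuclideanSpace ℝ (Fin n)) : Prop :=
  x ∈ p.feasible ∧ ∀ z ∈ p.feasible, p.P x ≤ p.P z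

/-- The Slater condition. -/
def Slater (p : DCProgram n m) : Prop := ∃ z ∈ p.C, ∀ i, p.g i z < 0

/-- The affine approximation of `g i` at `w`, evaluated at `u`. -/
def lin (p : DCProgram n m) (i : Fin m) (u w : EuclideanSpace ℝ (Fin n)) : ℝ :=
  p.g i w + inner ℝ (gradient (p.g i) w) (u - w)

/-- The constraint violation `max_i [g i x]₊`. -/
def violation [NeZero m] (p : DCProgram n m) (x : EuclideanSpace ℝ (Fin n)) : ℝ :=
  Finset.univ.sup' Finset.univ_nonempty (fun i => max (p.g i x) 0)

/-- `m̂ = inf {P₁ x : x ∈ C}`. -/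
def mhat (p : DCProgram n m) : ℝ := sInf (p.P₁ '' p.C)

/-- The penalty function `F_η(x) = (P₁ x - m̂) / η + δ_C(x) + max_i [g i x]₊`. -/
def F [NeZero m] (p : DCProgram n m) (η : ℝ) (x : EuclideanSpace ℝ (Fin n)) : EReal :=
  ((1 / η * (p.P₁ x - p.mhat) : ℝ) : EReal) + indicatorFn p.C x + ((p.violation x : ℝ) : EReal)

/-- The feasible set of the subproblem at the point `y`, in the variables `(x, s)`. -/
def subFeasible (p : DCProgram n m) (y : EuclideanSpace ℝ (Fin n)) :
    Set (EuclideanSpace ℝ (Fin n) × ℝ) :=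
  {q | q.1 ∈ p.C ∧ 0 ≤ q.2 ∧ ∀ i, p.lin i q.1 y ≤ q.2}

/-- The objective of the subproblem, in the variables `(x, s)`, with penalty parameter `θ`. -/
def subObjective (p : DCProgram n m) (Lg θ : ℝ) (ξ y : EuclideanSpace ℝ (Fin n))
    (q : EuclideanSpace ℝ (Fin n) × ℝ) : ℝ :=
  p.P₁ q.1 - inner ℝ ξ q.1 + θ * q.2 + θ * Lg / 2 * ‖q.1 - y‖ ^ 2

/-- The potential function
`E(x, y, θ) = (1 / θ) (P₁ x - m̂ + δ_C(x) + θ max_i [g i x]₊ + (θ L_g / 2) ‖x - y‖²)`. -/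
def E [NeZero m] (p : DCProgram n m) (Lg : ℝ)
    (x y : EuclideanSpace ℝ (Fin n)) (θ : ℝ) : EReal :=
  ((1 / θ : ℝ) : EReal) * (((p.P₁ x - p.mhat : ℝ) : EReal) + indicatorFn p.C x +
    ((θ * p.violation x + θ * Lg / 2 * ‖x - y‖ ^ 2 : ℝ) : EReal))

end DCProgram

/-- The convex setting: `P₂ = 0`, every `g i` is convex, and the moduli `ℓ i` are set to `0`. -/
structure ConvexSetting (p : DCProgram n m) (σ : ConstraintSplitting p) : Prop where
  P₂_eq : p.P₂ = 0
  convex_g : ∀ i, ConvexOn ℝ Set.univ (p.g i)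
  ℓ_eq : ∀ i, σ.ℓ i = 0

/-- The sequences `x, y, ξ, s, θ` are generated by the extended sequential quadratic method
with extrapolation, with parameters `β` and `d`. The convention `x⁻¹ = x⁰` is rendered by the
truncated subtraction `k - 1` on natural numbers, as `0 - 1 = 0`; the value `s 0` plays no role. -/
structure IsGenerated [NeZero m] (p : DCProgram n m) (σ : ConstraintSplitting p)
    (x y ξ : ℕ → EuclideanSpace ℝ (Fin n)) (s θ β : ℕ → ℝ) (d : ℝ) : Prop where
  x_zero : x 0 ∈ p.C
  θ_zero : 0 < θ 0
  d_pos : 0 < d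
  β_nonneg : ∀ k, 0 ≤ β k
  β_lt : ∀ k, β k < Real.sqrt (σ.Lg / (σ.Lg + σ.ℓg))
  β_sup_lt : (⨆ k, β k) < Real.sqrt (σ.Lg / (σ.Lg + σ.ℓg))
  y_eq : ∀ k, y k = x k + β k • (x k - x (k - 1))
  ξ_mem : ∀ k, ξ k ∈ subdifferential (fun z => ((p.P₂ z : ℝ) : EReal)) (x k)
  step_mem : ∀ k, (x (k + 1), s (k + 1)) ∈ p.subFeasible (y k)
  step_min : ∀ k, IsMinOn (p.subObjective σ.Lg (θ k) (ξ k) (y k)) (p.subFeasible (y k))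
    (x (k + 1), s (k + 1))
  θ_keep : ∀ k, (∀ i, p.lin i (x (k + 1)) (y k) ≤ 0) → θ (k + 1) = θ k
  θ_increase : ∀ k, (¬ ∀ i, p.lin i (x (k + 1)) (y k) ≤ 0) → θ (k + 1) = θ k + d

end Program

/-- The set of accumulation points (limits of subsequences) of a sequence. -/
def accumulationPoints {X : Type*} [TopologicalSpace X] (u : ℕ → X) : Set X :=
  {a | MapClusterPt a atTop u}

end

end ESQM

/-!
Linear convergence of the extrapolated sequential quadratic method in the convex setting.

Write `L = L_g` and let `f_θ = (P₁ - m̂) / θ + max_i [g_i]₊` be the penalty function. Each `g_i` is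
convex with `L`-Lipschitz gradient, so its linearization at `y^k` lies below `g_i` and differs from
it by at most `(L / 2) ‖· - y^k‖²`. The subproblem is strongly convex, and comparing its solution
with a point `z ∈ C` gives the inequality of a proximal gradient step,
`f_θ(x^{k+1}) + (L / 2) ‖z - x^{k+1}‖² ≤ f_θ(z) + (L / 2) ‖z - y^k‖²` with `θ = θ_k`
(`IsGenerated.penalty_step_le`). Everything else rests on this inequality.

With `z = x^k` it is the descent of the potential function. As `sup β_k < 1`, the steps
`x^{k+1} - x^k` tend to zero and the potential converges. When the penalty parameter is increased,
the slack variable is positive, and optimality in the direction of a Slater point with a *negative*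
slack bounds `θ_k` (`IsGenerated.eventually_θ_le_of_increase`); so `θ_k` is eventually constant, the
potential is then one fixed continuous function of the iterates, and it is constant on the
accumulation points.

With `z` a minimizer of `f_θ` over `C` the inequality shows that `f_θ(x^k)` tends to the minimal
value `f⋆`. For the rate, no subgradient of `f_θ` at the iterates is needed: let `w` be the proximal
point of `f_θ + δ_C` at `y^k` with step size `1 / (2L)`. Then `2L (y^k - w)` is a subgradient at `w`,
and combining the two optimality inequalities yields `‖w - y^k‖² ≤ 2 ‖x^{k+1} - y^k‖²`. The
Kurdyka–Łojasiewicz property with exponent `1 / 2`, uniform by compactness of `C`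
(`DCProgram.exists_error_bound`), bounds `f_θ(w) - f⋆` by a multiple of `‖w - y^k‖²`, whence
`f_θ(x^{k+1}) - f⋆` is at most a multiple of `‖x^{k+1} - y^k‖²`
(`IsGenerated.penalty_sub_le_of_error_bound`). Together with the descent this contracts the excess
of the potential by a fixed factor every two steps, the step lengths are dominated by a geometric
sequence, and the iterates converge at a linear rate. The limit satisfies the constraints because
the linearized constraints hold once `θ_k` is constant.
-/

namespace ESQM

section ConvexAnalysis

variable {E : Type*} [NormedAddCommGroup E] [InnerProductSpace ℝ E]

/-! ### First-order inequalities -/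

section Gradient

variable [CompleteSpace E] {f : E → ℝ}

theorem hasDerivAt_comp_lineMap (hf : Differentiable ℝ f) (w u : E) (t : ℝ) :
    HasDerivAt (f ∘ AffineMap.lineMap (k := ℝ) w u)
      (inner ℝ (gradient f (AffineMap.lineMap w u t)) (u - w)) t := by
  have h := (hf (AffineMap.lineMap w u t)).hasGradientAt.hasFDerivAt.comp_hasDerivAt t
    (AffineMap.hasDerivAt_lineMap (𝕜 := ℝ) (a := w) (b := u) (x := t))
  simpa using h

theorem _root_.ConvexOn.add_inner_gradient_le (hc : ConvexOn ℝ Set.univ f)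
    (hf : Differentiable ℝ f) (w u : E) :
    f w + inner ℝ (gradient f w) (u - w) ≤ f u := by
  have hφ : ConvexOn ℝ Set.univ (f ∘ AffineMap.lineMap (k := ℝ) w u) := by
    simpa using hc.comp_affineMap (AffineMap.lineMap (k := ℝ) w u)
  have hd := hasDerivAt_comp_lineMap hf w u 0
  have h := hφ.le_slope_of_hasDerivAt (Set.mem_univ 0) (Set.mem_univ 1) one_pos hd
  rw [slope_def_field, Function.comp_apply, Function.comp_apply, AffineMap.lineMap_apply_zero,
    AffineMap.lineMap_apply_one, sub_zero, div_one] at h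
  linarith

/-- The quadratic upper bound for a function with Lipschitz gradient. -/
theorem le_add_inner_gradient_add_sq (hf : Differentiable ℝ f) {K : ℝ≥0}
    (hK : LipschitzWith K (gradient f)) (w u : E) :
    f u ≤ f w + inner ℝ (gradient f w) (u - w) + K / 2 * ‖u - w‖ ^ 2 := by
  set φ : ℝ → ℝ := f ∘ AffineMap.lineMap (k := ℝ) w u with hφ
  set c : ℝ := inner ℝ (gradient f w) (u - w)
  have hd : ∀ t, HasDerivAt (fun t => φ t - t * c - K / 2 * ‖u - w‖ ^ 2 * t ^ 2)
      (inner ℝ (gradient f (AffineMap.lineMap w u t)) (u - w) - c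
        - K / 2 * ‖u - w‖ ^ 2 * (2 * t)) t := by
    intro t
    have h1 := hasDerivAt_comp_lineMap hf w u t
    have h2 : HasDerivAt (fun t : ℝ => t * c) c t := by
      simpa using (hasDerivAt_id t).mul_const c
    have h3 : HasDerivAt (fun t : ℝ => K / 2 * ‖u - w‖ ^ 2 * t ^ 2)
        (K / 2 * ‖u - w‖ ^ 2 * (2 * t)) t := by
      simpa using (hasDerivAt_pow 2 t).const_mul ((K : ℝ) / 2 * ‖u - w‖ ^ 2)
    exact (h1.sub h2).sub h3
  have hanti : AntitoneOn (fun t => φ t - t * c - K / 2 * ‖u - w‖ ^ 2 * t ^ 2)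
      (Set.Icc 0 1) := by
    refine antitoneOn_of_deriv_nonpos (convex_Icc 0 1)
      (fun t _ => (hd t).continuousAt.continuousWithinAt)
      (fun t _ => (hd t).differentiableAt.differentiableWithinAt) fun t ht => ?_
    rw [interior_Icc] at ht
    rw [(hd t).deriv]
    have h1 : inner ℝ (gradient f (AffineMap.lineMap w u t)) (u - w) - c
        = inner ℝ (gradient f (AffineMap.lineMap w u t) - gradient f w) (u - w) := by
      rw [inner_sub_left]
    have h2 := real_inner_le_norm
      (gradient f (AffineMap.lineMap w u t) - gradient f w) (u - w)
    have h3 : ‖gradient f (AffineMap.lineMap w u t) - gradient f w‖ ≤ K * (t * ‖u - w‖) := by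
      have := hK.dist_le_mul (AffineMap.lineMap w u t) w
      rwa [dist_lineMap_left, dist_eq_norm, Real.norm_eq_abs, abs_of_pos ht.1,
        dist_comm, dist_eq_norm] at this
    have h4 := mul_le_mul_of_nonneg_right h3 (norm_nonneg (u - w))
    rw [h1]
    nlinarith
  have h := hanti (Set.left_mem_Icc.2 zero_le_one) (Set.right_mem_Icc.2 zero_le_one) zero_le_one
  simp only [hφ, Function.comp_apply, AffineMap.lineMap_apply_zero,
    AffineMap.lineMap_apply_one] at h
  linarith

end Gradient

/-- If `q` minimizes `h + (μ / 2) ‖A · - y‖²` on an initial piece of the segment from `q` to `q'`,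
where `h` is convex, then `h` satisfies the first-order optimality condition in the direction
`q' - q`. The quadratic term is of second order along the segment, apart from its slope. -/
theorem _root_.ConvexOn.le_add_inner_of_isMin_segment {X : Type*} [AddCommGroup X] [Module ℝ X]
    {h : X → ℝ} (hh : ConvexOn ℝ Set.univ h) (A : X →ₗ[ℝ] E) (y : E) (μ : ℝ) (q q' : X)
    {t₀ : ℝ} (ht₀ : 0 < t₀)
    (hmin : ∀ t, 0 < t → t ≤ t₀ → h q + μ / 2 * ‖A q - y‖ ^ 2 ≤
      h (q + t • (q' - q)) + μ / 2 * ‖A (q + t • (q' - q)) - y‖ ^ 2) :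
    h q ≤ h q' + μ * inner ℝ (A q - y) (A q' - A q) := by
  have key : ∀ t, 0 < t → t ≤ min t₀ 1 →
      0 ≤ (h q' - h q + μ * inner ℝ (A q - y) (A q' - A q))
        + t * (μ / 2 * ‖A q' - A q‖ ^ 2) := by
    intro t ht ht1
    have h1 := hmin t ht (ht1.trans (min_le_left _ _))
    have ht2 : t ≤ 1 := ht1.trans (min_le_right _ _)
    have h2 := hh.2 (Set.mem_univ q) (Set.mem_univ q') (sub_nonneg.2 ht2) ht.le (by ring)
    have e1 : (1 - t) • q + t • q' = q + t • (q' - q) := by module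
    have e2 : A (q + t • (q' - q)) - y = (A q - y) + t • (A q' - A q) := by
      simp only [map_add, map_smul, map_sub]; module
    rw [e1, smul_eq_mul, smul_eq_mul] at h2
    rw [e2, norm_add_sq_real, inner_smul_right, norm_smul, mul_pow, Real.norm_eq_abs, sq_abs]
      at h1
    refine nonneg_of_mul_nonneg_right ?_ ht
    nlinarith
  have hlim : Tendsto (fun t : ℝ => (h q' - h q + μ * inner ℝ (A q - y) (A q' - A q))
      + t * (μ / 2 * ‖A q' - A q‖ ^ 2)) (𝓝[>] 0)
      (𝓝 (h q' - h q + μ * inner ℝ (A q - y) (A q' - A q))) := by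
    have : Continuous (fun t : ℝ => (h q' - h q + μ * inner ℝ (A q - y) (A q' - A q))
      + t * (μ / 2 * ‖A q' - A q‖ ^ 2)) := by fun_prop
    simpa using this.continuousWithinAt (s := Set.Ioi 0) (x := 0) |>.tendsto
  have := ge_of_tendsto hlim (by
    filter_upwards [Ioc_mem_nhdsGT (lt_min ht₀ one_pos)] with t ht using key t ht.1 ht.2)
  linarith

/-- Polarization of the slope in the first-order condition of a proximal step. -/
theorem two_mul_inner_sub_sub (a y z : E) :
    2 * inner ℝ (a - y) (z - a) = ‖z - y‖ ^ 2 - ‖a - y‖ ^ 2 - ‖z - a‖ ^ 2 := by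
  have h : z - y = (a - y) + (z - a) := by abel
  rw [h, norm_add_sq_real]; ring

/-! ### Subdifferentials -/

theorem regularSubdifferential_zero_subset (w : E) :
    regularSubdifferential (fun _ : E => ((0 : ℝ) : EReal)) w ⊆ {0} := by
  rintro ζ ⟨-, hζ⟩
  by_contra hne
  rw [Set.mem_singleton_iff] at hne
  have hpos : 0 < ‖ζ‖ := norm_pos_iff.2 hne
  have hlt : ((-(‖ζ‖ / 2) : ℝ) : EReal) < 0 := by exact_mod_cast (by linarith : -(‖ζ‖ / 2) < 0)
  have hev := eventually_lt_of_lt_liminf (hlt.trans_le hζ)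
  -- along `w + t ζ` with `t ↓ 0` the difference quotient equals `-‖ζ‖`
  have htend : Tendsto (fun t : ℝ => w + t • ζ) (𝓝[>] 0) (𝓝[≠] w) := by
    refine tendsto_nhdsWithin_iff.2 ⟨?_, ?_⟩
    · have : Continuous (fun t : ℝ => w + t • ζ) := by fun_prop
      simpa using (this.continuousWithinAt (s := Set.Ioi 0) (x := 0)).tendsto
    · filter_upwards [self_mem_nhdsWithin] with t ht
      simp [hne, (Set.mem_Ioi.1 ht).ne']
  obtain ⟨t, ht, ht0⟩ := ((htend.eventually hev).and self_mem_nhdsWithin).exists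
  replace ht0 : 0 < t := ht0
  beta_reduce at ht
  rw [← EReal.coe_sub, ← EReal.coe_sub, ← EReal.coe_div, EReal.coe_lt_coe_iff] at ht
  rw [add_sub_cancel_left, inner_smul_right, real_inner_self_eq_norm_sq, norm_smul,
    Real.norm_eq_abs, abs_of_pos ht0, lt_div_iff₀ (by positivity)] at ht
  nlinarith [mul_pos ht0 (mul_pos hpos hpos)]

theorem subdifferential_zero_subset (w : E) :
    subdifferential (fun _ : E => ((0 : ℝ) : EReal)) w ⊆ {0} := by
  rintro ξ ⟨-, u, ζ, -, -, hζ, hmem⟩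
  have h0 : ζ = fun _ => 0 := funext fun k => regularSubdifferential_zero_subset _ (hmem k)
  rw [h0] at hζ
  exact tendsto_nhds_unique hζ tendsto_const_nhds

/-- A subgradient in the sense of convex analysis is a limiting subgradient. -/
theorem mem_subdifferential_of_forall_add_inner_le {f : E → EReal} {w ξ : E} {c : ℝ}
    (hw : f w = c) (h : ∀ v, ((c + inner ℝ ξ (v - w) : ℝ) : EReal) ≤ f v) :
    ξ ∈ subdifferential f w := by
  have hdom : w ∈ effDom f := by
    change f w < ⊤
    rw [hw]; exact EReal.coe_lt_top c
  refine ⟨hdom, fun _ => w, fun _ => ξ, tendsto_const_nhds, tendsto_const_nhds,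
    tendsto_const_nhds, fun _ => ⟨hdom, le_liminf_of_le (h := Eventually.of_forall fun v => ?_)⟩⟩
  refine EReal.div_nonneg ?_ (by exact_mod_cast norm_nonneg _)
  rw [hw]
  have hv := h v
  induction hfv : f v with
  | bot => rw [hfv] at hv; exact absurd hv (by simp)
  | top => simp
  | coe a =>
    rw [hfv, EReal.coe_le_coe_iff] at hv
    rw [← EReal.coe_sub, ← EReal.coe_sub]
    exact_mod_cast (by linarith : 0 ≤ a - c - inner ℝ ξ (v - w))

end ConvexAnalysis

/-! ### The exact penalty function -/

theorem DCProgram.mhat_le {n m : ℕ} {p : DCProgram n m} {x : EuclideanSpace ℝ (Fin n)}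
    (hx : x ∈ p.C) : p.mhat ≤ p.P₁ x :=
  csInf_le (p.compact_C.image p.convex_P₁.locallyLipschitz.continuous).bddBelow
    (Set.mem_image_of_mem _ hx)

section Penalty

variable {n m : ℕ} [NeZero m] {p : DCProgram n m}

/-- The real-valued penalty function `(P₁ x - m̂) / η + max_i [g i x]₊`, which agrees with
`p.F η` on `C`. -/
noncomputable def DCProgram.penalty (p : DCProgram n m) (η : ℝ)
    (x : EuclideanSpace ℝ (Fin n)) : ℝ :=
  1 / η * (p.P₁ x - p.mhat) + p.violation x

/-- The real-valued form of the potential function, which agrees with `p.E Lg` where its first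
argument lies in `C`. -/
noncomputable def DCProgram.potential (p : DCProgram n m) (Lg : ℝ)
    (x y : EuclideanSpace ℝ (Fin n)) (η : ℝ) : ℝ :=
  p.penalty η x + Lg / 2 * ‖x - y‖ ^ 2

namespace DCProgram

theorem g_le_violation (i : Fin m) (x : EuclideanSpace ℝ (Fin n)) : p.g i x ≤ p.violation x :=
  (le_max_left _ 0).trans
    (Finset.le_sup' (fun i => max (p.g i x) 0) (Finset.mem_univ i))

theorem violation_nonneg (x : EuclideanSpace ℝ (Fin n)) : 0 ≤ p.violation x :=
  (le_max_right (p.g 0 x) 0).trans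
    (Finset.le_sup' (fun i => max (p.g i x) 0) (Finset.mem_univ 0))

theorem violation_le {x : EuclideanSpace ℝ (Fin n)} {c : ℝ} (hc : 0 ≤ c)
    (h : ∀ i, p.g i x ≤ c) : p.violation x ≤ c :=
  Finset.sup'_le _ _ fun i _ => max_le (h i) hc

theorem violation_eq_zero {x : EuclideanSpace ℝ (Fin n)} (h : ∀ i, p.g i x ≤ 0) :
    p.violation x = 0 :=
  (violation_le le_rfl h).antisymm (violation_nonneg x)

theorem convexOn_violation (hg : ∀ i, ConvexOn ℝ Set.univ (p.g i)) :
    ConvexOn ℝ Set.univ p.violation := by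
  refine ⟨convex_univ, fun u _ w _ a b ha hb hab => violation_le ?_ fun i => ?_⟩
  · exact add_nonneg (mul_nonneg ha (violation_nonneg u)) (mul_nonneg hb (violation_nonneg w))
  · exact ((hg i).2 (Set.mem_univ u) (Set.mem_univ w) ha hb hab).trans
      (add_le_add (mul_le_mul_of_nonneg_left (g_le_violation i u) ha)
        (mul_le_mul_of_nonneg_left (g_le_violation i w) hb))

theorem convexOn_penalty (hg : ∀ i, ConvexOn ℝ Set.univ (p.g i)) {η : ℝ} (hη : 0 < η) :
    ConvexOn ℝ Set.univ (p.penalty η) :=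
  ((p.convex_P₁.sub (concaveOn_const _ convex_univ)).smul (one_div_pos.2 hη).le).add
    (convexOn_violation hg)

theorem continuous_penalty (hg : ∀ i, ConvexOn ℝ Set.univ (p.g i)) {η : ℝ} (hη : 0 < η) :
    Continuous (p.penalty η) :=
  (convexOn_penalty hg hη).locallyLipschitz.continuous

theorem penalty_nonneg {η : ℝ} (hη : 0 < η) {x : EuclideanSpace ℝ (Fin n)} (hx : x ∈ p.C) :
    0 ≤ p.penalty η x :=
  add_nonneg (mul_nonneg (one_div_pos.2 hη).le (sub_nonneg.2 (mhat_le hx))) (violation_nonneg x)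

/-- The penalty function decreases in its parameter, because `P₁ ≥ m̂` on `C`. -/
theorem penalty_anti {η η' : ℝ} (hη : 0 < η) (h : η ≤ η') {x : EuclideanSpace ℝ (Fin n)}
    (hx : x ∈ p.C) : p.penalty η' x ≤ p.penalty η x :=
  add_le_add (mul_le_mul_of_nonneg_right (one_div_le_one_div_of_le hη h)
    (sub_nonneg.2 (mhat_le hx))) le_rfl

theorem F_of_mem (η : ℝ) {x : EuclideanSpace ℝ (Fin n)} (hx : x ∈ p.C) :
    p.F η x = (p.penalty η x : ℝ) := by
  simp only [F, indicatorFn, if_pos hx, add_zero, penalty, EReal.coe_add]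

theorem F_of_notMem (η : ℝ) {x : EuclideanSpace ℝ (Fin n)} (hx : x ∉ p.C) : p.F η x = ⊤ := by
  simp only [F, indicatorFn, if_neg hx]
  rw [EReal.coe_add_top, EReal.top_add_coe]

theorem E_of_mem (Lg : ℝ) {x : EuclideanSpace ℝ (Fin n)} (hx : x ∈ p.C)
    (y : EuclideanSpace ℝ (Fin n)) {η : ℝ} (hη : 0 < η) :
    p.E Lg x y η = (p.potential Lg x y η : ℝ) := by
  simp only [E, indicatorFn, if_pos hx, add_zero, potential, penalty]
  rw [← EReal.coe_add, ← EReal.coe_mul, EReal.coe_eq_coe_iff]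
  field_simp
  ring

end DCProgram

end Penalty

/-! ### The linearized constraints in the convex setting -/

section Linearization

variable {n m : ℕ} {p : DCProgram n m} {σ : ConstraintSplitting p}

/-- The segment from a feasible point of the subproblem towards `(z, r)` satisfies the linearized
constraints even when `r < 0`; the sign constraint on the second variable has to be supplied. -/
theorem DCProgram.add_smul_mem_subFeasible (p : DCProgram n m) {y z : EuclideanSpace ℝ (Fin n)}
    {q : EuclideanSpace ℝ (Fin n) × ℝ} (hq : q ∈ p.subFeasible y) (hz : z ∈ p.C) {r t : ℝ}
    (hr : ∀ i, p.lin i z y ≤ r) (ht : 0 ≤ t) (ht1 : t ≤ 1) (hpos : 0 ≤ q.2 + t * (r - q.2)) :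
    q + t • ((z, r) - q) ∈ p.subFeasible y := by
  refine ⟨?_, hpos, fun i => ?_⟩
  · have := p.convex_C hq.1 hz (sub_nonneg.2 ht1) ht (by ring)
    have e : (1 - t) • q.1 + t • z = q.1 + t • (z - q.1) := by module
    rwa [e] at this
  · have e : q.1 + t • (z - q.1) - y = (1 - t) • (q.1 - y) + t • (z - y) := by module
    have hlin : p.lin i (q.1 + t • (z - q.1)) y
        = (1 - t) * p.lin i q.1 y + t * p.lin i z y := by
      simp only [DCProgram.lin, e, inner_add_right, inner_smul_right]
      ring
    change p.lin i (q.1 + t • (z - q.1)) y ≤ q.2 + t * (r - q.2)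
    rw [hlin]
    linarith [mul_le_mul_of_nonneg_left (hq.2.2 i) (sub_nonneg.2 ht1),
      mul_le_mul_of_nonneg_left (hr i) ht]

namespace ConvexSetting

theorem lin_le (hc : ConvexSetting p σ) (i : Fin m) (u w : EuclideanSpace ℝ (Fin n)) :
    p.lin i u w ≤ p.g i u :=
  (hc.convex_g i).add_inner_gradient_le (p.differentiable_g i) w u

/-- The gradient of the subtracted part `σ.g₂ i` is constant, so the modulus of the gradient of
`σ.g₁ i` is also one for the gradient of `p.g i`. -/
theorem lipschitzWith_gradient (hc : ConvexSetting p σ) (i : Fin m) :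
    LipschitzWith (σ.L i) (gradient (p.g i)) := by
  have hsub : ∀ x, gradient (p.g i) x = gradient (σ.g₁ i) x - gradient (σ.g₂ i) x := by
    intro x
    have h : p.g i = fun x => σ.g₁ i x - σ.g₂ i x := funext (σ.g_eq i)
    rw [h]
    unfold gradient
    rw [fderiv_fun_sub (σ.differentiable_g₁ i x) (σ.differentiable_g₂ i x), map_sub]
  refine LipschitzWith.of_dist_le_mul fun u w => ?_
  have h2 : gradient (σ.g₂ i) u = gradient (σ.g₂ i) w := by
    have h := (σ.lipschitz_g₂ i).dist_le_mul u w
    rw [hc.ℓ_eq i, NNReal.coe_zero, zero_mul] at h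
    exact dist_le_zero.1 h
  rw [hsub, hsub, h2, dist_sub_right]
  exact (σ.lipschitz_g₁ i).dist_le_mul u w

theorem le_lin_add_sq [NeZero m] (hc : ConvexSetting p σ) (i : Fin m)
    (u w : EuclideanSpace ℝ (Fin n)) :
    p.g i u ≤ p.lin i u w + σ.Lg / 2 * ‖u - w‖ ^ 2 := by
  refine (le_add_inner_gradient_add_sq (p.differentiable_g i)
    (hc.lipschitzWith_gradient i) w u).trans ?_
  have : (σ.L i : ℝ) ≤ σ.Lg := Finset.le_sup' (fun i => (σ.L i : ℝ)) (Finset.mem_univ i)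
  unfold DCProgram.lin
  gcongr

theorem ℓg_eq_zero [NeZero m] (hc : ConvexSetting p σ) : σ.ℓg = 0 := by
  simp [ConstraintSplitting.ℓg, hc.ℓ_eq]

end ConvexSetting

theorem ConstraintSplitting.Lg_pos [NeZero m] (σ : ConstraintSplitting p) : 0 < σ.Lg :=
  lt_of_lt_of_le (NNReal.coe_pos.2 (σ.L_pos 0))
    (Finset.le_sup' (fun i => (σ.L i : ℝ)) (Finset.mem_univ 0))

end Linearization

/-! ### The iterates -/

section Iterates

variable {n m : ℕ} [NeZero m] {p : DCProgram n m} {σ : ConstraintSplitting p}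
  {x y ξ : ℕ → EuclideanSpace ℝ (Fin n)} {s θ β : ℕ → ℝ} {d : ℝ}

namespace IsGenerated

theorem x_mem (h : IsGenerated p σ x y ξ s θ β d) : ∀ k, x k ∈ p.C
  | 0 => h.x_zero
  | k + 1 => (h.step_mem k).1

theorem θ_mono (h : IsGenerated p σ x y ξ s θ β d) : Monotone θ := by
  refine monotone_nat_of_le_succ fun k => ?_
  by_cases hk : ∀ i, p.lin i (x (k + 1)) (y k) ≤ 0
  · exact (h.θ_keep k hk).ge
  · rw [h.θ_increase k hk]
    linarith [h.d_pos]

theorem θ_pos (h : IsGenerated p σ x y ξ s θ β d) (k : ℕ) : 0 < θ k :=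
  h.θ_zero.trans_le (h.θ_mono (Nat.zero_le k))

theorem exists_β_le (h : IsGenerated p σ x y ξ s θ β d) (hc : ConvexSetting p σ) :
    ∃ b < 1, ∀ k, β k ≤ b := by
  have h1 : Real.sqrt (σ.Lg / (σ.Lg + σ.ℓg)) = 1 := by
    rw [hc.ℓg_eq_zero, add_zero, div_self σ.Lg_pos.ne', Real.sqrt_one]
  have hlt := h.β_lt
  have hsup := h.β_sup_lt
  rw [h1] at hlt hsup
  exact ⟨_, hsup, le_ciSup ⟨1, by rintro _ ⟨k, rfl⟩; exact (hlt k).le⟩⟩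

theorem ξ_eq_zero (h : IsGenerated p σ x y ξ s θ β d) (hc : ConvexSetting p σ) (k : ℕ) :
    ξ k = 0 := by
  have := h.ξ_mem k
  rw [hc.P₂_eq] at this
  exact subdifferential_zero_subset _ this

/-- First-order optimality of the subproblem in the direction of a point `q'`, which itself
need not be feasible as long as an initial piece of the segment towards it is. -/
theorem variational_inequality (h : IsGenerated p σ x y ξ s θ β d) (hc : ConvexSetting p σ)
    (k : ℕ) (q' : EuclideanSpace ℝ (Fin n) × ℝ) {t₀ : ℝ} (ht₀ : 0 < t₀)
    (hq : ∀ t, 0 < t → t ≤ t₀ →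
      (x (k + 1), s (k + 1)) + t • (q' - (x (k + 1), s (k + 1))) ∈ p.subFeasible (y k)) :
    p.P₁ (x (k + 1)) + θ k * s (k + 1) ≤ p.P₁ q'.1 + θ k * q'.2
      + θ k * σ.Lg * inner ℝ (x (k + 1) - y k) (q'.1 - x (k + 1)) := by
  have hconv : ConvexOn ℝ Set.univ
      (fun q : EuclideanSpace ℝ (Fin n) × ℝ => p.P₁ q.1 + θ k * q.2) := by
    have h1 : ConvexOn ℝ Set.univ (fun q : EuclideanSpace ℝ (Fin n) × ℝ => p.P₁ q.1) :=
      ⟨convex_univ, fun u _ w _ _ _ ha hb hab =>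
        p.convex_P₁.2 (Set.mem_univ u.1) (Set.mem_univ w.1) ha hb hab⟩
    have h2 : ConvexOn ℝ Set.univ (fun q : EuclideanSpace ℝ (Fin n) × ℝ => θ k * q.2) :=
      (θ k • LinearMap.snd ℝ (EuclideanSpace ℝ (Fin n)) ℝ).convexOn convex_univ
    exact h1.add h2
  refine hconv.le_add_inner_of_isMin_segment (LinearMap.fst ℝ (EuclideanSpace ℝ (Fin n)) ℝ)
    (y k) (θ k * σ.Lg) (x (k + 1), s (k + 1)) q' ht₀ fun t ht ht' => ?_
  have hmin := h.step_min k (hq t ht ht')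
  simpa [DCProgram.subObjective, h.ξ_eq_zero hc k] using hmin

/-- One step of the method compared with an arbitrary point of `C`. As the subproblem is
strongly convex, this is the inequality of an exact proximal gradient step for the penalty
function with the current parameter. -/
theorem penalty_step_le (h : IsGenerated p σ x y ξ s θ β d) (hc : ConvexSetting p σ) (k : ℕ)
    {z : EuclideanSpace ℝ (Fin n)} (hz : z ∈ p.C) :
    p.penalty (θ k) (x (k + 1)) + σ.Lg / 2 * ‖z - x (k + 1)‖ ^ 2 ≤
      p.penalty (θ k) z + σ.Lg / 2 * ‖z - y k‖ ^ 2 := by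
  have hθ := h.θ_pos k
  obtain ⟨hxC, hs0, hsl⟩ := h.step_mem k
  have hvi := h.variational_inequality hc k (z, p.violation z) one_pos fun t ht ht1 => by
    refine p.add_smul_mem_subFeasible (h.step_mem k) hz
      (fun i => (hc.lin_le i z (y k)).trans (p.g_le_violation i z)) ht.le ht1 ?_
    dsimp only at hs0 ⊢
    nlinarith [mul_nonneg (sub_nonneg.2 ht1) hs0, mul_nonneg ht.le (p.violation_nonneg z)]
  have hV : p.violation (x (k + 1)) ≤ s (k + 1) + σ.Lg / 2 * ‖x (k + 1) - y k‖ ^ 2 := by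
    have := σ.Lg_pos
    refine p.violation_le (add_nonneg hs0 (by positivity)) fun i => ?_
    exact (hc.le_lin_add_sq i _ (y k)).trans (add_le_add (hsl i) le_rfl)
  have hpol := two_mul_inner_sub_sub (x (k + 1)) (y k) z
  dsimp only at hvi
  have h1 : p.P₁ (x (k + 1)) + θ k * p.violation (x (k + 1))
      + θ k * (σ.Lg / 2 * ‖z - x (k + 1)‖ ^ 2)
      ≤ p.P₁ z + θ k * p.violation z + θ k * (σ.Lg / 2 * ‖z - y k‖ ^ 2) := by
    have h2 := mul_le_mul_of_nonneg_left hV hθ.le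
    have h3 : θ k * σ.Lg * inner ℝ (x (k + 1) - y k) (z - x (k + 1))
        = θ k * σ.Lg / 2 * (‖z - y k‖ ^ 2 - ‖x (k + 1) - y k‖ ^ 2 - ‖z - x (k + 1)‖ ^ 2) := by
      rw [← hpol]; ring
    rw [h3] at hvi
    linarith
  have h4 : ∀ w r : ℝ, ∀ v, 1 / θ k * (w - p.mhat) + v + r
      = (w + θ k * v + θ k * r - p.mhat) / θ k := by
    intro w r v
    field_simp
    ring
  unfold DCProgram.penalty
  rw [h4, h4]
  exact div_le_div_of_nonneg_right (by linarith) hθ.le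

end IsGenerated

end Iterates

/-! ### Descent and linear convergence of real sequences -/

section RealSequences

variable {H a : ℕ → ℝ} {c : ℝ}

theorem exists_tendsto_of_descent (hH : ∀ k, 0 ≤ H k) (ha : ∀ k, 0 ≤ a k) (hc : 0 < c)
    (hdesc : ∀ k, H (k + 1) ≤ H k - c * a k) :
    (∃ ω, Tendsto H atTop (𝓝 ω)) ∧ Tendsto a atTop (𝓝 0) := by
  have hanti : Antitone H := antitone_nat_of_succ_le fun k => by
    have := mul_nonneg hc.le (ha k)
    linarith [hdesc k]
  have hlim := tendsto_atTop_ciInf hanti ⟨0, by rintro _ ⟨k, rfl⟩; exact hH k⟩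
  refine ⟨⟨_, hlim⟩, ?_⟩
  have hdiff : Tendsto (fun k => (H k - H (k + 1)) / c) atTop (𝓝 0) := by
    have := (hlim.sub (hlim.comp (tendsto_add_atTop_nat 1))).div_const c
    simpa using this
  refine squeeze_zero ha (fun k => ?_) hdiff
  rw [le_div_iff₀ hc]
  linarith [hdesc k]

/-- The two bounds give `H (k + 1) ≤ (D / c) (H k - H (k + 2))`, so that `H` contracts by a fixed
factor every two steps. -/
theorem exists_geometric_bound_of_descent {D : ℝ} (hH : ∀ k, 0 ≤ H k) (ha : ∀ k, 0 ≤ a k)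
    (hc : 0 < c) (hD : 0 < D) (hdesc : ∀ k, H (k + 1) ≤ H k - c * a k)
    (herr : ∀ k, H (k + 1) ≤ D * (a (k + 1) + a k)) :
    ∃ A, 0 < A ∧ ∃ t, 0 < t ∧ t < 1 ∧ ∀ k, H k ≤ A * t ^ k := by
  have hanti : ∀ k, H (k + 1) ≤ H k := fun k => by
    have := mul_nonneg hc.le (ha k)
    linarith [hdesc k]
  have hcD : 0 < c / D := div_pos hc hD
  have hq0 : 0 < 1 / (1 + c / D) := by positivity
  have hq1 : 1 / (1 + c / D) < 1 := by
    rw [div_lt_one (by positivity)]; linarith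
  have hstep : ∀ k, H (k + 2) ≤ 1 / (1 + c / D) * H k := by
    intro k
    have h1 := herr k
    have h2 : c / D * H (k + 1) ≤ c * (a (k + 1) + a k) := by
      rw [div_mul_eq_mul_div, div_le_iff₀ hD]
      nlinarith [mul_le_mul_of_nonneg_left h1 hc.le]
    have h3 := hdesc k
    have h4 : H (k + 2) ≤ H (k + 1) - c * a (k + 1) := hdesc (k + 1)
    have h5 := mul_le_mul_of_nonneg_left (hanti (k + 1)) hcD.le
    rw [one_div, inv_mul_eq_div, le_div_iff₀ (by positivity)]
    linarith [show H (k + 2) = H (k + 1 + 1) from rfl]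
  set t := Real.sqrt (1 / (1 + c / D)) with ht
  have ht0 : 0 < t := Real.sqrt_pos.2 hq0
  have ht1 : t < 1 := by rw [ht, Real.sqrt_lt' one_pos]; simpa using hq1
  have htsq : t ^ 2 = 1 / (1 + c / D) := Real.sq_sqrt hq0.le
  refine ⟨(H 0 + 1) / t, by have := hH 0; positivity, t, ht0, ht1, fun k => ?_⟩
  induction k using Nat.twoStepInduction with
  | zero =>
    rw [pow_zero, mul_one, le_div_iff₀ ht0]
    nlinarith [hH 0]
  | one =>
    rw [pow_one, div_mul_cancel₀ _ ht0.ne']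
    linarith [hanti 0]
  | more k ih _ =>
    calc H (k + 2) ≤ t ^ 2 * H k := by rw [htsq]; exact hstep k
      _ ≤ t ^ 2 * ((H 0 + 1) / t * t ^ k) := by gcongr
      _ = (H 0 + 1) / t * t ^ (k + 2) := by ring

theorem exists_tendsto_of_sq_norm_sub_le_geometric {E : Type*} [NormedAddCommGroup E]
    [CompleteSpace E] {u : ℕ → E} {A t : ℝ} (hA : 0 < A) (ht : 0 < t) (ht1 : t < 1)
    (hu : ∀ k, ‖u (k + 1) - u k‖ ^ 2 ≤ A * t ^ k) :
    ∃ a, Tendsto u atTop (𝓝 a) ∧ ∃ B, 0 < B ∧ ∃ r, 0 < r ∧ r < 1 ∧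
      ∀ k, ‖u k - a‖ ≤ B * r ^ k := by
  have hr0 : 0 < Real.sqrt t := Real.sqrt_pos.2 ht
  have hr1 : Real.sqrt t < 1 := by rw [Real.sqrt_lt' one_pos]; simpa using ht1
  have hdist : ∀ k, dist (u k) (u (k + 1)) ≤ Real.sqrt A * Real.sqrt t ^ k := by
    intro k
    rw [dist_comm, dist_eq_norm]
    refine le_of_sq_le_sq ?_ (by positivity)
    rw [mul_pow, Real.sq_sqrt hA.le, ← pow_mul, mul_comm k 2, pow_mul, Real.sq_sqrt ht.le]
    exact hu k
  obtain ⟨a, ha⟩ := cauchySeq_tendsto_of_complete (cauchySeq_of_le_geometric _ _ hr1 hdist)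
  refine ⟨a, ha, Real.sqrt A / (1 - Real.sqrt t),
    div_pos (Real.sqrt_pos.2 hA) (sub_pos.2 hr1), _, hr0, hr1, fun k => ?_⟩
  have := dist_le_of_le_geometric_of_tendsto _ _ hr1 hdist ha k
  rw [dist_eq_norm] at this
  rwa [div_mul_eq_mul_div]

end RealSequences

/-! ### Descent of the potential function and exactness of the penalty -/

section Asymptotics

variable {n m : ℕ} [NeZero m] {p : DCProgram n m} {σ : ConstraintSplitting p}
  {x y ξ : ℕ → EuclideanSpace ℝ (Fin n)} {s θ β : ℕ → ℝ} {d : ℝ}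

namespace IsGenerated

theorem potential_step_le (h : IsGenerated p σ x y ξ s θ β d) (hc : ConvexSetting p σ) (k : ℕ) :
    p.potential σ.Lg (x (k + 1)) (x k) (θ k) ≤ p.potential σ.Lg (x k) (x (k - 1)) (θ k)
      - (1 - β k ^ 2) * σ.Lg / 2 * ‖x k - x (k - 1)‖ ^ 2 := by
  have h1 := h.penalty_step_le hc k (h.x_mem k)
  have h2 : ‖x k - y k‖ ^ 2 = β k ^ 2 * ‖x k - x (k - 1)‖ ^ 2 := by
    rw [h.y_eq, sub_add_cancel_left, norm_neg, norm_smul, mul_pow, Real.norm_eq_abs, sq_abs]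
  rw [h2, norm_sub_rev] at h1
  unfold DCProgram.potential
  linarith

theorem potential_descent (h : IsGenerated p σ x y ξ s θ β d) (hc : ConvexSetting p σ) (k : ℕ) :
    p.potential σ.Lg (x (k + 1)) (x k) (θ (k + 1)) ≤ p.potential σ.Lg (x k) (x (k - 1)) (θ k)
      - (1 - β k ^ 2) * σ.Lg / 2 * ‖x k - x (k - 1)‖ ^ 2 :=
  (add_le_add (p.penalty_anti (h.θ_pos k) (h.θ_mono k.le_succ) (h.x_mem (k + 1))) le_rfl).trans
    (h.potential_step_le hc k)

/-- The bound on the extrapolation parameters gives descent with a uniform constant. -/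
theorem exists_uniform_descent (h : IsGenerated p σ x y ξ s θ β d) (hc : ConvexSetting p σ) :
    ∃ c > 0, ∀ k, p.potential σ.Lg (x (k + 1)) (x k) (θ (k + 1)) ≤
      p.potential σ.Lg (x k) (x (k - 1)) (θ k) - c * ‖x k - x (k - 1)‖ ^ 2 := by
  obtain ⟨b, hb1, hb⟩ := h.exists_β_le hc
  have hL := σ.Lg_pos
  have hb0 : 0 ≤ b := (h.β_nonneg 0).trans (hb 0)
  refine ⟨(1 - b ^ 2) * σ.Lg / 2, ?_, fun k => (h.potential_descent hc k).trans ?_⟩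
  · have : 0 < 1 - b ^ 2 := by nlinarith
    positivity
  · have := pow_le_pow_left₀ (h.β_nonneg k) (hb k) 2
    gcongr

theorem potential_nonneg (h : IsGenerated p σ x y ξ s θ β d) (k : ℕ) :
    0 ≤ p.potential σ.Lg (x k) (x (k - 1)) (θ k) := by
  have := σ.Lg_pos
  exact add_nonneg (p.penalty_nonneg (h.θ_pos k) (h.x_mem k)) (by positivity)

theorem exists_tendsto_potential (h : IsGenerated p σ x y ξ s θ β d) (hc : ConvexSetting p σ) :
    ∃ ω, Tendsto (fun k => p.potential σ.Lg (x k) (x (k - 1)) (θ k)) atTop (𝓝 ω) := by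
  obtain ⟨c, hc0, hdesc⟩ := h.exists_uniform_descent hc
  exact (exists_tendsto_of_descent h.potential_nonneg (fun k => sq_nonneg _) hc0 hdesc).1

theorem tendsto_norm_sub_pred (h : IsGenerated p σ x y ξ s θ β d) (hc : ConvexSetting p σ) :
    Tendsto (fun k => ‖x k - x (k - 1)‖) atTop (𝓝 0) := by
  obtain ⟨c, hc0, hdesc⟩ := h.exists_uniform_descent hc
  have := (exists_tendsto_of_descent h.potential_nonneg (fun k => sq_nonneg _) hc0 hdesc).2
  simpa [Real.sqrt_sq] using this.sqrt

theorem norm_step_sub_extrapolation_le (h : IsGenerated p σ x y ξ s θ β d)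
    (hc : ConvexSetting p σ) (k : ℕ) :
    ‖x (k + 1) - y k‖ ≤ ‖x (k + 1) - x k‖ + ‖x k - x (k - 1)‖ := by
  obtain ⟨b, hb1, hb⟩ := h.exists_β_le hc
  have e : x (k + 1) - y k = (x (k + 1) - x k) - β k • (x k - x (k - 1)) := by
    rw [h.y_eq]; abel
  rw [e]
  refine (norm_sub_le _ _).trans (add_le_add le_rfl ?_)
  rw [norm_smul, Real.norm_eq_abs, abs_of_nonneg (h.β_nonneg k)]
  exact mul_le_of_le_one_left (norm_nonneg _) ((hb k).trans hb1.le)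

theorem tendsto_norm_step_sub_extrapolation (h : IsGenerated p σ x y ξ s θ β d)
    (hc : ConvexSetting p σ) : Tendsto (fun k => ‖x (k + 1) - y k‖) atTop (𝓝 0) := by
  have h1 := h.tendsto_norm_sub_pred hc
  have h2 := (h1.comp (tendsto_add_atTop_nat 1)).add h1
  rw [add_zero] at h2
  exact squeeze_zero (fun k => norm_nonneg _) (h.norm_step_sub_extrapolation_le hc) h2

theorem tendsto_inner_step (h : IsGenerated p σ x y ξ s θ β d) (hc : ConvexSetting p σ)
    (z : EuclideanSpace ℝ (Fin n)) :
    Tendsto (fun k => inner ℝ (x (k + 1) - y k) (z - x (k + 1))) atTop (𝓝 0) := by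
  obtain ⟨R, hR⟩ := p.compact_C.isBounded.exists_norm_le
  have h1 := (h.tendsto_norm_step_sub_extrapolation hc).mul_const (‖z‖ + R)
  rw [zero_mul] at h1
  refine squeeze_zero_norm (fun k => (norm_inner_le_norm _ _).trans ?_) h1
  gcongr
  exact (norm_sub_le _ _).trans (add_le_add le_rfl (hR _ (h.x_mem (k + 1))))

/-- Whenever the penalty parameter is increased the slack `s (k + 1)` is positive, so the
direction from the iterate towards `(z, -δ)`, with `z` a Slater point of slack `δ`, is feasible.
The first-order condition in this direction bounds the parameter. -/
theorem eventually_θ_le_of_increase (h : IsGenerated p σ x y ξ s θ β d) (hc : ConvexSetting p σ)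
    (hs : p.Slater) :
    ∃ M, ∀ᶠ k in atTop, (¬ ∀ i, p.lin i (x (k + 1)) (y k) ≤ 0) → θ k ≤ M := by
  obtain ⟨z, hz, hgz⟩ := hs
  obtain ⟨δ, hδ, hgδ⟩ : ∃ δ > 0, ∀ i, p.g i z ≤ -δ := by
    refine ⟨-Finset.univ.sup' Finset.univ_nonempty (fun i => p.g i z), ?_, fun i => ?_⟩
    · rw [gt_iff_lt, neg_pos, Finset.sup'_lt_iff]
      exact fun i _ => hgz i
    · rw [neg_neg]
      exact Finset.le_sup' (fun i => p.g i z) (Finset.mem_univ i)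
  refine ⟨(p.P₁ z - p.mhat) / (δ / 2), ?_⟩
  have hlim := (h.tendsto_inner_step hc z).const_mul σ.Lg
  rw [mul_zero] at hlim
  filter_upwards [hlim.eventually_lt_const (half_pos hδ)] with k hk hinc
  push Not at hinc
  obtain ⟨i, hi⟩ := hinc
  have hspos : 0 < s (k + 1) := hi.trans_le ((h.step_mem k).2.2 i)
  have hvi := h.variational_inequality hc k (z, -δ) (t₀ := s (k + 1) / (s (k + 1) + δ))
    (by positivity) fun t ht ht1 => by
      rw [le_div_iff₀ (by positivity)] at ht1
      refine p.add_smul_mem_subFeasible (h.step_mem k) hz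
        (fun i => (hc.lin_le i z (y k)).trans (hgδ i)) ht.le ?_ ?_
      · by_contra! hlt
        nlinarith
      · dsimp only
        linarith
  dsimp only at hvi
  have hm := p.mhat_le (h.x_mem (k + 1))
  have hθ := h.θ_pos k
  rw [le_div_iff₀ (half_pos hδ)]
  nlinarith [mul_pos hθ hspos, mul_lt_mul_of_pos_left hk hθ]

/-- The penalty parameter is bounded, and its increments are at least `d`. -/
theorem exists_θ_eventually_eq (h : IsGenerated p σ x y ξ s θ β d) (hc : ConvexSetting p σ)
    (hs : p.Slater) :
    ∃ N, ∀ k ≥ N, θ k = θ N ∧ ∀ i, p.lin i (x (k + 1)) (y k) ≤ 0 := by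
  obtain ⟨M, hM⟩ := h.eventually_θ_le_of_increase hc hs
  obtain ⟨K, hK⟩ := eventually_atTop.1 hM
  have hbdd : ∀ k ≥ K, θ k ≤ max (θ K) (M + d) := by
    intro k hk
    induction k, hk using Nat.le_induction with
    | base => exact le_max_left _ _
    | succ k hk ih =>
      by_cases hinc : ∀ i, p.lin i (x (k + 1)) (y k) ≤ 0
      · rwa [h.θ_keep k hinc]
      · rw [h.θ_increase k hinc]
        exact (add_le_add (hK k hk hinc) le_rfl).trans (le_max_right _ _)
  have hbdd' : BddAbove (Set.range θ) := by
    refine ⟨max (θ K) (M + d), ?_⟩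
    rintro _ ⟨k, rfl⟩
    exact (h.θ_mono (le_max_left k K)).trans (hbdd _ (le_max_right k K))
  have hlim := tendsto_atTop_ciSup h.θ_mono hbdd'
  have hdiff := (hlim.comp (tendsto_add_atTop_nat 1)).sub hlim
  rw [sub_self] at hdiff
  obtain ⟨N, hN⟩ := eventually_atTop.1 (hdiff.eventually_lt_const h.d_pos)
  have hlin : ∀ k ≥ N, ∀ i, p.lin i (x (k + 1)) (y k) ≤ 0 := by
    intro k hk
    by_contra hinc
    have h1 := hN k hk
    rw [Function.comp_apply, h.θ_increase k hinc] at h1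
    linarith
  refine ⟨N, fun k hk => ⟨?_, hlin k hk⟩⟩
  induction k, hk using Nat.le_induction with
  | base => rfl
  | succ k hk ih => rw [h.θ_keep k (hlin k hk), ih]

end IsGenerated

/-! ### Accumulation points -/

namespace IsGenerated

/-- The iterates eventually stay in the compact set `C × C × {θ N}`, on which the potential function
is continuous. -/
theorem accumulationPoints_properties (h : IsGenerated p σ x y ξ s θ β d)
    (hc : ConvexSetting p σ) (hs : p.Slater) :
    (accumulationPoints (fun k => (x (k + 1), x k, θ k))).Nonempty ∧
      IsCompact (accumulationPoints (fun k => (x (k + 1), x k, θ k))) ∧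
      ∃ ω : ℝ, Tendsto (fun k => p.E σ.Lg (x (k + 1)) (x k) (θ k)) atTop (𝓝 (ω : EReal)) ∧
        ∀ a ∈ accumulationPoints (fun k => (x (k + 1), x k, θ k)),
          p.E σ.Lg a.1 a.2.1 a.2.2 = (ω : EReal) := by
  obtain ⟨N, hN⟩ := h.exists_θ_eventually_eq hc hs
  obtain ⟨ω, hω⟩ := h.exists_tendsto_potential hc
  have hθN := h.θ_pos N
  set K := p.C ×ˢ p.C ×ˢ ({θ N} : Set ℝ) with hKdef
  have hK : IsCompact K := p.compact_C.prod (p.compact_C.prod isCompact_singleton)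
  have hmem : ∀ᶠ k in atTop, (x (k + 1), x k, θ k) ∈ K := by
    filter_upwards [eventually_ge_atTop N] with k hk
    exact ⟨h.x_mem _, h.x_mem _, (hN k hk).1⟩
  have hsub : accumulationPoints (fun k => (x (k + 1), x k, θ k)) ⊆ K := fun a ha => by
    by_contra haK
    obtain ⟨k, hk, hk'⟩ := (ha.frequently (hK.isClosed.isOpen_compl.mem_nhds haK)).and_eventually
      hmem |>.exists
    exact hk hk'
  have hpot : Tendsto (fun k => p.potential σ.Lg (x (k + 1)) (x k) (θ N)) atTop (𝓝 ω) := by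
    refine (hω.comp (tendsto_add_atTop_nat 1)).congr' ?_
    filter_upwards [eventually_ge_atTop N] with k hk
    simp only [Function.comp_apply, Nat.add_sub_cancel]
    rw [(hN (k + 1) (hk.trans k.le_succ)).1]
  refine ⟨?_, hK.of_isClosed_subset isClosed_setOfPred_clusterPt hsub, ω, ?_, fun a ha => ?_⟩
  · obtain ⟨a, -, ha⟩ := hK.exists_mapClusterPt_of_frequently hmem.frequently
    exact ⟨a, ha⟩
  · refine ((continuous_coe_real_ereal.tendsto ω).comp hpot).congr' ?_
    filter_upwards [eventually_ge_atTop N] with k hk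
    rw [(hN k hk).1, p.E_of_mem σ.Lg (h.x_mem _) _ hθN, Function.comp_apply]
  · obtain ⟨h1, -, h3⟩ := hsub ha
    rw [Set.mem_singleton_iff] at h3
    rw [h3, p.E_of_mem σ.Lg h1 _ hθN, EReal.coe_eq_coe_iff]
    have hcont : Continuous (fun a : EuclideanSpace ℝ (Fin n) × EuclideanSpace ℝ (Fin n) × ℝ =>
        p.potential σ.Lg a.1 a.2.1 (θ N)) := by
      have := p.continuous_penalty hc.convex_g hθN
      unfold DCProgram.potential
      fun_prop
    have hcl := MapClusterPt.tendsto_comp (hcont.tendsto a) ha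
    have hne : (𝓝 (p.potential σ.Lg a.1 a.2.1 (θ N)) ⊓ 𝓝 ω).NeBot :=
      NeBot.mono hcl (inf_le_inf_left _ hpot)
    exact eq_of_nhds_neBot hne

end IsGenerated

end Asymptotics

/-! ### Error bound from the Kurdyka–Łojasiewicz property -/

theorem deriv_mul_rpow_half {ρ t : ℝ} (ht : 0 < t) :
    deriv (fun t : ℝ => ρ * t ^ (1 - (1 / 2 : ℝ))) t = ρ / 2 / Real.sqrt t := by
  rw [((Real.hasDerivAt_rpow_const (p := 1 - 1 / 2) (Or.inl ht.ne')).const_mul ρ).deriv]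
  have : (1 - 1 / 2 - 1 : ℝ) = -(1 / 2) := by norm_num
  rw [this, Real.rpow_neg ht.le, ← Real.sqrt_eq_rpow]
  ring

section ErrorBound

variable {n m : ℕ} [NeZero m] {p : DCProgram n m}

namespace DCProgram

theorem mem_subdifferential_F {η : ℝ} {w ζ : EuclideanSpace ℝ (Fin n)} (hw : w ∈ p.C)
    (h : ∀ v ∈ p.C, p.penalty η w + inner ℝ ζ (v - w) ≤ p.penalty η v) :
    ζ ∈ subdifferential (p.F η) w := by
  refine mem_subdifferential_of_forall_add_inner_le (p.F_of_mem η hw) fun v => ?_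
  by_cases hv : v ∈ p.C
  · rw [p.F_of_mem η hv, EReal.coe_le_coe_iff]
    exact h v hv
  · rw [p.F_of_notMem η hv]
    exact le_top

/-- The Kurdyka–Łojasiewicz inequality with exponent `1 / 2` at the minimizers of the penalty
function over `C`, made uniform by the compactness of `C`. Points of `C` that are not minimizers
have a neighborhood free of points with nearly minimal value. -/
theorem exists_error_bound {η : ℝ} (hcont : Continuous (p.penalty η))
    (hKL : IsKLFunctionWithExponent (p.F η) (1 / 2)) {z : EuclideanSpace ℝ (Fin n)}
    (hmin : ∀ v ∈ p.C, p.penalty η z ≤ p.penalty η v) :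
    ∃ r > 0, ∃ K > 0, ∀ u ∈ p.C, p.penalty η u < p.penalty η z + r →
      ∀ ζ ∈ subdifferential (p.F η) u, p.penalty η u - p.penalty η z ≤ K * ‖ζ‖ ^ 2 := by
  refine p.compact_C.induction_on (p := fun S => ∃ r > 0, ∃ K > 0, ∀ u ∈ S,
    p.penalty η u < p.penalty η z + r → ∀ ζ ∈ subdifferential (p.F η) u,
      p.penalty η u - p.penalty η z ≤ K * ‖ζ‖ ^ 2) ⟨1, one_pos, 1, one_pos, by simp⟩ ?_ ?_ ?_
  · rintro S T hST ⟨r, hr, K, hK, h⟩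
    exact ⟨r, hr, K, hK, fun u hu => h u (hST hu)⟩
  · rintro S T ⟨r, hr, K, hK, h⟩ ⟨r', hr', K', hK', h'⟩
    refine ⟨min r r', lt_min hr hr', max K K', lt_max_of_lt_left hK, ?_⟩
    rintro u (hu | hu) hur ζ hζ
    · refine (h u hu (hur.trans_le (by gcongr; exact min_le_left _ _)) ζ hζ).trans ?_
      gcongr
      exact le_max_left _ _
    · refine (h' u hu (hur.trans_le (by gcongr; exact min_le_right _ _)) ζ hζ).trans ?_
      gcongr
      exact le_max_right _ _
  · intro a ha
    rcases (hmin a ha).lt_or_eq with hlt | heq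
    -- `a` is not a minimizer: the value near `a` exceeds the minimum by at least `r`
    · set r := (p.penalty η a - p.penalty η z) / 2 with hr
      have hr0 : 0 < r := half_pos (sub_pos.2 hlt)
      have hev : ∀ᶠ u in 𝓝 a, p.penalty η z + r < p.penalty η u :=
        hcont.continuousAt.eventually_const_lt (by linarith)
      exact ⟨_, mem_nhdsWithin_of_mem_nhds hev, r, hr0, 1, one_pos,
        fun u hu hu' => absurd hu' (not_lt.2 (le_of_lt hu))⟩
    -- `a` is a minimizer, so that `0` is a subgradient and the inequality holds near `a`
    · have hdom : a ∈ domSubdifferential (p.F η) := ⟨0, p.mem_subdifferential_F ha fun v hv => by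
        rw [inner_zero_left, add_zero, ← heq]; exact hmin v hv⟩
      obtain ⟨-, -, ρ, hρ, -, r, hr, -, U, hU, hineq⟩ := hKL.exponent a hdom
      obtain ⟨r₁, hr₁, hr₁r⟩ := EReal.lt_iff_exists_real_btwn.1 hr
      rw [EReal.coe_pos] at hr₁
      refine ⟨U ∩ p.C, inter_mem (mem_nhdsWithin_of_mem_nhds hU) self_mem_nhdsWithin, r₁, hr₁,
        ρ ^ 2 / 4, by positivity, ?_⟩
      rintro u ⟨hu, huC⟩ hur ζ hζ
      rcases le_or_gt (p.penalty η u) (p.penalty η z) with hle | hgt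
      · exact (sub_nonpos.2 hle).trans (by positivity)
      have h1 : p.F η a < p.F η u := by
        rw [p.F_of_mem η ha, p.F_of_mem η huC, EReal.coe_lt_coe_iff, ← heq]
        exact hgt
      have h2 : p.F η u < p.F η a + r := by
        rw [p.F_of_mem η ha, p.F_of_mem η huC, ← heq]
        calc ((p.penalty η u : ℝ) : EReal) < ((p.penalty η z + r₁ : ℝ) : EReal) := by
              exact_mod_cast hur
          _ = (p.penalty η z : EReal) + r₁ := EReal.coe_add _ _
          _ ≤ _ := add_le_add le_rfl hr₁r.le
      have h3 := hineq u hu h1 h2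
      rw [p.F_of_mem η ha, p.F_of_mem η huC, EReal.toReal_coe, EReal.toReal_coe, ← heq,
        deriv_mul_rpow_half (sub_pos.2 hgt)] at h3
      set Δ := p.penalty η u - p.penalty η z with hΔ
      have hΔ0 : 0 < Δ := sub_pos.2 hgt
      have hsq : 0 < Real.sqrt Δ := Real.sqrt_pos.2 hΔ0
      have h4 : (1 : ENNReal) ≤ ENNReal.ofReal (ρ / 2 / Real.sqrt Δ * ‖ζ‖) := by
        rw [ENNReal.ofReal_mul (by positivity)]
        refine h3.trans ?_
        gcongr
        refine (Metric.infEDist_le_edist_of_mem hζ).trans_eq ?_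
        rw [edist_dist, dist_zero_left]
      rw [ENNReal.one_le_ofReal, div_mul_eq_mul_div, one_le_div hsq] at h4
      have h5 := pow_le_pow_left₀ hsq.le h4 2
      rw [Real.sq_sqrt hΔ0.le] at h5
      linarith

/-- The proximal point of `y` with step size `1 / μ` for the penalty function over `C`. -/
theorem exists_prox {η : ℝ} (hconv : ConvexOn ℝ Set.univ (p.penalty η)) (μ : ℝ)
    (y : EuclideanSpace ℝ (Fin n)) :
    ∃ w ∈ p.C, ∀ v ∈ p.C, p.penalty η w + inner ℝ (μ • (y - w)) (v - w) ≤ p.penalty η v := by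
  have hcont : Continuous (fun v => p.penalty η v + μ / 2 * ‖v - y‖ ^ 2) := by
    have := hconv.locallyLipschitz.continuous
    fun_prop
  obtain ⟨w, hw, hmin⟩ := p.compact_C.exists_isMinOn p.nonempty_C hcont.continuousOn
  refine ⟨w, hw, fun v hv => ?_⟩
  have h := hconv.le_add_inner_of_isMin_segment LinearMap.id y μ w v one_pos fun t ht ht1 => by
    have hmem := p.convex_C hw hv (sub_nonneg.2 ht1) ht.le (by ring)
    have e : (1 - t) • w + t • v = w + t • (v - w) := by module
    rw [e] at hmem
    exact hmin hmem
  have e : inner ℝ (μ • (y - w)) (v - w) = -(μ * inner ℝ (w - y) (v - w)) := by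
    rw [real_inner_smul_left, ← neg_sub w y, inner_neg_left]; ring
  rw [e]
  simp only [LinearMap.id_apply] at h
  linarith

end DCProgram

end ErrorBound

/-! ### Convergence of the iterates -/

section Convergence

variable {n m : ℕ} [NeZero m] {p : DCProgram n m} {σ : ConstraintSplitting p}
  {x y ξ : ℕ → EuclideanSpace ℝ (Fin n)} {s θ β : ℕ → ℝ} {d : ℝ}

namespace IsGenerated

/-- The penalty values converge to the minimal one, because in the step inequality with `z` a
minimizer the two quadratic terms differ by a null sequence. -/
theorem tendsto_penalty (h : IsGenerated p σ x y ξ s θ β d) (hc : ConvexSetting p σ) {N : ℕ}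
    (hN : ∀ k ≥ N, θ k = θ N) {z : EuclideanSpace ℝ (Fin n)} (hz : z ∈ p.C)
    (hmin : ∀ v ∈ p.C, p.penalty (θ N) z ≤ p.penalty (θ N) v) :
    Tendsto (fun k => p.penalty (θ N) (x k)) atTop (𝓝 (p.penalty (θ N) z)) := by
  rw [← tendsto_add_atTop_iff_nat 1]
  have hup : Tendsto (fun k => p.penalty (θ N) z + σ.Lg / 2 *
      (2 * inner ℝ (x (k + 1) - y k) (z - x (k + 1)) + ‖x (k + 1) - y k‖ ^ 2)) atTop
      (𝓝 (p.penalty (θ N) z)) := by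
    have := ((((h.tendsto_inner_step hc z).const_mul 2).add
      ((h.tendsto_norm_step_sub_extrapolation hc).pow 2)).const_mul (σ.Lg / 2)).const_add
      (p.penalty (θ N) z)
    simpa using this
  refine tendsto_of_tendsto_of_tendsto_of_le_of_le' tendsto_const_nhds hup
    (Eventually.of_forall fun k => hmin _ (h.x_mem (k + 1))) ?_
  filter_upwards [eventually_ge_atTop N] with k hk
  have h1 := h.penalty_step_le hc k hz
  rw [hN k hk] at h1
  rw [two_mul_inner_sub_sub]
  linarith

/-- The step of the method at `y k` is close to the exact proximal point `w` of the penalty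
function at `y k`, in the sense that `‖w - y k‖` is controlled by `‖x (k + 1) - y k‖`. The
residual `y k - w` is up to a factor a subgradient at `w`, so the error bound applies at `w`, and
one more step inequality transfers the estimate to `x (k + 1)`. -/
theorem penalty_sub_le_of_error_bound (h : IsGenerated p σ x y ξ s θ β d)
    (hc : ConvexSetting p σ) {f r K : ℝ} (hK : 0 < K) {k : ℕ}
    (herr : ∀ u ∈ p.C, p.penalty (θ k) u < f + r →
      ∀ ζ ∈ subdifferential (p.F (θ k)) u, p.penalty (θ k) u - f ≤ K * ‖ζ‖ ^ 2)
    (hk : p.penalty (θ k) (x (k + 1)) + σ.Lg * ‖x (k + 1) - y k‖ ^ 2 < f + r) :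
    p.penalty (θ k) (x (k + 1)) - f ≤
      (8 * K * σ.Lg ^ 2 + σ.Lg) * ‖x (k + 1) - y k‖ ^ 2 := by
  have hL := σ.Lg_pos
  obtain ⟨w, hw, hprox⟩ := p.exists_prox (p.convexOn_penalty hc.convex_g (h.θ_pos k))
    (2 * σ.Lg) (y k)
  have h1 := h.penalty_step_le hc k hw
  have h2 := hprox _ (h.x_mem (k + 1))
  have e : inner ℝ ((2 * σ.Lg) • (y k - w)) (x (k + 1) - w)
      = -(σ.Lg * (‖x (k + 1) - y k‖ ^ 2 - ‖w - y k‖ ^ 2 - ‖x (k + 1) - w‖ ^ 2)) := by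
    rw [← two_mul_inner_sub_sub, real_inner_smul_left, ← neg_sub w (y k), inner_neg_left]
    ring
  rw [e] at h2
  rw [norm_sub_rev w (x (k + 1))] at h1
  have hwx := mul_nonneg hL.le (sq_nonneg ‖x (k + 1) - w‖)
  have hwy := mul_nonneg hL.le (sq_nonneg ‖w - y k‖)
  have hclose : σ.Lg * ‖w - y k‖ ^ 2 ≤ σ.Lg * (2 * ‖x (k + 1) - y k‖ ^ 2) := by linarith
  have hclose' := le_of_mul_le_mul_left hclose hL
  have h3 := herr w hw (by linarith) _ (p.mem_subdifferential_F hw hprox)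
  rw [norm_smul, mul_pow, Real.norm_eq_abs, sq_abs, norm_sub_rev] at h3
  have h4 : K * ((2 * σ.Lg) ^ 2 * ‖w - y k‖ ^ 2) ≤
      K * ((2 * σ.Lg) ^ 2 * (2 * ‖x (k + 1) - y k‖ ^ 2)) := by gcongr
  linarith

/-- From the index where the penalty parameter is constant and the error bound applies, the excess
of the potential satisfies the hypotheses of `exists_geometric_bound_of_descent`, with the squared
step lengths as `a`. -/
theorem exists_linear_rate (h : IsGenerated p σ x y ξ s θ β d) (hc : ConvexSetting p σ) {N : ℕ}
    (hN : ∀ k ≥ N, θ k = θ N) (hKL : IsKLFunctionWithExponent (p.F (θ N)) (1 / 2))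
    {z : EuclideanSpace ℝ (Fin n)} (hz : z ∈ p.C)
    (hmin : ∀ v ∈ p.C, p.penalty (θ N) z ≤ p.penalty (θ N) v) :
    ∃ a, Tendsto x atTop (𝓝 a) ∧ ∃ c₀ : ℝ, 0 < c₀ ∧ ∃ t : ℝ, 0 < t ∧ t < 1 ∧ ∃ k₀ : ℕ,
      ∀ k > k₀, ‖x k - a‖ ≤ c₀ * t ^ k := by
  have hL := σ.Lg_pos
  obtain ⟨r, hr, K, hK, herr⟩ := p.exists_error_bound
    (p.continuous_penalty hc.convex_g (h.θ_pos N)) hKL hmin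
  have hlim := ((h.tendsto_penalty hc hN hz hmin).comp (tendsto_add_atTop_nat 1)).add
    (((h.tendsto_norm_step_sub_extrapolation hc).pow 2).const_mul σ.Lg)
  obtain ⟨M₀, hM₀⟩ := eventually_atTop.1 (hlim.eventually_lt_const
    (u := p.penalty (θ N) z + r) (by simpa using hr))
  set M := max N M₀ with hM
  have hθ : ∀ j, θ (M + j) = θ N := fun j => hN _ ((le_max_left N M₀).trans (Nat.le_add_right M j))
  obtain ⟨c, hc0, hdesc⟩ := h.exists_uniform_descent hc
  set D := 2 * (8 * K * σ.Lg ^ 2 + σ.Lg) + σ.Lg / 2 with hD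
  have hD0 : 0 < D := by positivity
  obtain ⟨A, hA, t, ht0, ht1, hgeo⟩ := exists_geometric_bound_of_descent (c := c) (D := D)
    (H := fun j => p.potential σ.Lg (x (M + j)) (x (M + j - 1)) (θ N) - p.penalty (θ N) z)
    (a := fun j => ‖x (M + j) - x (M + j - 1)‖ ^ 2)
    (fun j => by
      have h1 := hmin _ (h.x_mem (M + j))
      have h2 : 0 ≤ σ.Lg / 2 * ‖x (M + j) - x (M + j - 1)‖ ^ 2 := by positivity
      unfold DCProgram.potential
      linarith)
    (fun j => sq_nonneg _) hc0 hD0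
    (fun j => by
      have h1 := hdesc (M + j)
      rw [show M + j + 1 = M + (j + 1) from rfl, hθ, hθ] at h1
      change p.potential σ.Lg (x (M + (j + 1))) (x (M + j)) (θ N) - _ ≤ _
      linarith)
    (fun j => by
      change p.potential σ.Lg (x (M + j + 1)) (x (M + j)) (θ N) - _ ≤
        D * (‖x (M + j + 1) - x (M + j)‖ ^ 2 + ‖x (M + j) - x (M + j - 1)‖ ^ 2)
      have h1 : p.penalty (θ N) (x (M + j + 1)) - p.penalty (θ N) z ≤
          (8 * K * σ.Lg ^ 2 + σ.Lg) * ‖x (M + j + 1) - y (M + j)‖ ^ 2 := by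
        rw [← hθ j] at herr ⊢
        refine h.penalty_sub_le_of_error_bound hc hK herr ?_
        have := hM₀ (M + j) ((le_max_right N M₀).trans (Nat.le_add_right M j))
        rw [← hθ j] at this
        exact this
      have h2 := pow_le_pow_left₀ (norm_nonneg _) (h.norm_step_sub_extrapolation_le hc (M + j)) 2
      have h3 := h2.trans add_sq_le
      have h4 := mul_le_mul_of_nonneg_left h3
        (by positivity : 0 ≤ 8 * K * σ.Lg ^ 2 + σ.Lg)
      have h5 : 0 ≤ σ.Lg / 2 * ‖x (M + j) - x (M + j - 1)‖ ^ 2 := by positivity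
      unfold DCProgram.potential
      rw [hD]
      linarith)
  obtain ⟨a, ha, B, hB, τ, hτ0, hτ1, hrate⟩ := exists_tendsto_of_sq_norm_sub_le_geometric
    (u := fun j => x (M + j)) (A := 2 / σ.Lg * A) (t := t) (by positivity) ht0 ht1 fun j => by
      have h1 := hgeo (j + 1)
      change p.potential σ.Lg (x (M + j + 1)) (x (M + j)) (θ N) - _ ≤ _ at h1
      change ‖x (M + j + 1) - x (M + j)‖ ^ 2 ≤ _
      have h2 := hmin _ (h.x_mem (M + j + 1))
      have h3 : A * t ^ (j + 1) ≤ A * t ^ j :=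
        mul_le_mul_of_nonneg_left (pow_le_pow_of_le_one ht0.le ht1.le j.le_succ) hA.le
      unfold DCProgram.potential at h1
      rw [mul_assoc, div_mul_eq_mul_div, le_div_iff₀ hL]
      linarith
  refine ⟨a, ?_, B / τ ^ M, by positivity, τ, hτ0, hτ1, M, fun k hk => ?_⟩
  · rw [← tendsto_add_atTop_iff_nat M]
    simpa only [add_comm] using ha
  · obtain ⟨j, rfl⟩ := Nat.exists_eq_add_of_le hk.le
    refine (hrate j).trans_eq ?_
    rw [pow_add]
    field_simp

/-- Once the penalty parameter is constant the linearized constraints hold at every step, so the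
limit is feasible; at feasible points the penalty function orders points as the objective does. -/
theorem isMinimizer_of_tendsto (h : IsGenerated p σ x y ξ s θ β d) (hc : ConvexSetting p σ)
    {N : ℕ} (hN : ∀ k ≥ N, θ k = θ N ∧ ∀ i, p.lin i (x (k + 1)) (y k) ≤ 0)
    {z : EuclideanSpace ℝ (Fin n)} (hz : z ∈ p.C)
    (hmin : ∀ v ∈ p.C, p.penalty (θ N) z ≤ p.penalty (θ N) v) {a : EuclideanSpace ℝ (Fin n)}
    (ha : Tendsto x atTop (𝓝 a)) : p.IsMinimizer a := by
  have haC : a ∈ p.C := p.compact_C.isClosed.mem_of_tendsto ha (Eventually.of_forall h.x_mem)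
  have hag : ∀ i, p.g i a ≤ 0 := by
    intro i
    have h1 := ((p.differentiable_g i).continuous.tendsto a).comp
      (ha.comp (tendsto_add_atTop_nat 1))
    have h2 := ((h.tendsto_norm_step_sub_extrapolation hc).pow 2).const_mul (σ.Lg / 2)
    rw [zero_pow two_ne_zero, mul_zero] at h2
    refine le_of_tendsto_of_tendsto h1 h2 ?_
    filter_upwards [eventually_ge_atTop N] with k hk
    have h3 := hc.le_lin_add_sq i (x (k + 1)) (y k)
    exact h3.trans (add_le_of_nonpos_left ((hN k hk).2 i))
  refine ⟨⟨haC, hag⟩, fun v hv => ?_⟩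
  have hval : p.penalty (θ N) a = p.penalty (θ N) z :=
    tendsto_nhds_unique (((p.continuous_penalty hc.convex_g (h.θ_pos N)).tendsto a).comp ha)
      (h.tendsto_penalty hc (fun k hk => (hN k hk).1) hz hmin)
  have hle := hval.trans_le (hmin v hv.1)
  unfold DCProgram.penalty at hle
  rw [p.violation_eq_zero hag, p.violation_eq_zero hv.2, add_zero, add_zero] at hle
  have := le_of_mul_le_mul_left hle (one_div_pos.2 (h.θ_pos N))
  simp only [DCProgram.P, hc.P₂_eq, Pi.zero_apply, sub_zero]
  linarith

end IsGenerated

end Convergence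

end ESQM

theorem mainTheorem2 {n m : ℕ} [NeZero m] (p : ESQM.DCProgram n m)
    (σ : ESQM.ConstraintSplitting p) (hconv : ESQM.ConvexSetting p σ) (hslater : p.Slater)
    (x y ξ : ℕ → EuclideanSpace ℝ (Fin n)) (s θ β : ℕ → ℝ) (d : ℝ)
    (hgen : ESQM.IsGenerated p σ x y ξ s θ β d) :
    -- (i) sufficient descent of the potential function
    (∀ k : ℕ, 1 ≤ k →
      p.E σ.Lg (x (k + 1)) (x k) (θ (k + 1)) ≤
        p.E σ.Lg (x k) (x (k - 1)) (θ k) -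
          (((1 - β k ^ 2) * σ.Lg / 2 * ‖x k - x (k - 1)‖ ^ 2 : ℝ) : EReal)) ∧
    -- (ii) the accumulation points of `(x^{k+1}, x^k, θ_k)`
    ((ESQM.accumulationPoints (fun k => (x (k + 1), x k, θ k))).Nonempty ∧
      IsCompact (ESQM.accumulationPoints (fun k => (x (k + 1), x k, θ k))) ∧
      ∃ ω : ℝ,
        Tendsto (fun k => p.E σ.Lg (x (k + 1)) (x k) (θ k)) atTop (𝓝 (ω : EReal)) ∧
        ∀ a ∈ ESQM.accumulationPoints (fun k => (x (k + 1), x k, θ k)),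
          p.E σ.Lg a.1 a.2.1 a.2.2 = (ω : EReal)) ∧
    -- (iii) `θ_k` has an eventual constant value, and the local linear convergence holds
    (∃ θhat : ℝ, (∃ N₀ : ℕ, ∀ k ≥ N₀, θ k = θhat) ∧
      (ESQM.IsKLFunctionWithExponent (p.F θhat) (1 / 2) →
        ∃ xstar : EuclideanSpace ℝ (Fin n),
          p.IsMinimizer xstar ∧ Tendsto x atTop (𝓝 xstar) ∧
          ∃ c₀ : ℝ, 0 < c₀ ∧ ∃ t : ℝ, 0 < t ∧ t < 1 ∧ ∃ k₀ : ℕ,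
            ∀ k > k₀, ‖x k - xstar‖ ≤ c₀ * t ^ k)) := by
  refine ⟨fun k _ => ?_, hgen.accumulationPoints_properties hconv hslater, ?_⟩
  · rw [p.E_of_mem σ.Lg (hgen.x_mem _) _ (hgen.θ_pos _),
      p.E_of_mem σ.Lg (hgen.x_mem _) _ (hgen.θ_pos _), ← EReal.coe_sub, EReal.coe_le_coe_iff]
    exact hgen.potential_descent hconv k
  · obtain ⟨N, hN⟩ := hgen.exists_θ_eventually_eq hconv hslater
    refine ⟨θ N, ⟨N, fun k hk => (hN k hk).1⟩, fun hKL => ?_⟩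
    obtain ⟨z, hz, hmin⟩ := p.compact_C.exists_isMinOn p.nonempty_C
      (p.continuous_penalty hconv.convex_g (hgen.θ_pos N)).continuousOn
    obtain ⟨a, ha, hrate⟩ :=
      hgen.exists_linear_rate hconv (fun k hk => (hN k hk).1) hKL hz fun v hv => hmin hv
    exact ⟨a, hgen.isMinimizer_of_tendsto hconv hN hz (fun v hv => hmin hv) ha, ha, hrate⟩
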